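/- Let $\mathbb{N}=\{1,2,3,\dots\}$. For $k\in\mathbb{N}$, a sequence $\psi:\mathbb{N}\to\mathbb{C}$ is a $k$-step nilsequence if there are a $k$-step nilpotent Lie group $G$ (that is, of step at most $k$, and not necessarily connected), a discrete cocompact subgroup $\Gamma\le G$, a continuous function $F:G/\Gamma\to\mathbb{C}$, an element $g\in G$ and a point $x\in G/\Gamma$ such that $\psi(n)=F(g^n\cdot x)$ for all $n\in\mathbb{N}$. A sequence $\psi$ is a uniform limit of $k$-step nilsequences if for every $\varepsilon>0$ there is a $k$-step nilsequence $\psi_\varepsilon$ with $|\psi(n)-\psi_\varepsilon(n)|<\varepsilon$ for all $n\in\mathbb{N}$; for $k=1$ it is called almost periodic. A set $E=\{r_1<r_2<\cdots\}\subset\mathbb{N}$ is $k$-step-$I_0$ if for every bounded complex sequence $(b(n))_{n\in\mathbb{N}}$ there is a uniform limit $\psi$ of $k$-step nilsequences such that $\psi(r_n)=b(n)$ for all $n\in\mathbb{N}$. A sequence $s_1<s_2<\cdots$ in $\mathbb{N}$ is lacunary if $\inf_{n} s_{n+1}/s_n>1$. **Proposition 1.6.** 1. There is a set $E\subset\mathbb{N}$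 that is $2$-step-$I_0$ but not $1$-step-$I_0$. 2. Every sufficiently fast-growing lacunary sequence provides an example: there are $C\in\mathbb{N}$ and a function $\Phi:\mathbb{N}\to\mathbb{N}$ such that, for every lacunary sequence $(s_n)_{n\in\mathbb{N}}$ in $\mathbb{N}$ with $s_1\ge C$ and $s_{n+1}\ge\Phi(s_n)$ for all $n\in\mathbb{N}$, the set $E=\{s_n:n\in\mathbb{N}\}\cup\{s_n+n:n\in\mathbb{N}\}$ is $2$-step-$I_0$ but not $1$-step-$I_0$, and the set of squares $\{m^2:m\in E\}$ is $1$-step-$I_0$. 3. If $(\theta(n))_{n\in\mathbb{N}}$ is almost periodic, then $(\theta(n^2))_{n\in\mathbb{N}}$ is a uniform limit of $2$-step nilsequences. -/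

import Mathlib

open scoped Manifold ContDiff

/-- A (compact) nilmanifold `G ⧸ Γ` of step `k`: `G` is a real finite-dimensional smooth Lie group
(Hausdorff, second countable, without boundary, not necessarily connected), nilpotent of step
(at most) `k`, and `Γ` is a discrete cocompact subgroup of `G`.
In Mathlib's indexing the lower central series starts with `G` itself at index `0`. -/
structure Nilmanifold (k : ℕ) where
  /-- the ambient Lie group -/
  G : Type
  [group : Group G]
  [topology : TopologicalSpace G]
  [t2 : T2Space G]
  [secondCountable : SecondCountableTopology G]
  /-- the vector space on which the manifold `G` is modelled -/
  V : Type
  [normedAddCommGroup : NormedAddCommGroup V]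
  [normedSpace : NormedSpace ℝ V]
  [finiteDimensional : FiniteDimensional ℝ V]
  /-- the model space of the manifold `G`; it is homeomorphic to `V`, as `I` has no boundary -/
  H : Type
  [topologyH : TopologicalSpace H]
  I : ModelWithCorners ℝ V H
  [boundaryless : I.Boundaryless]
  [chartedSpace : ChartedSpace H G]
  [lieGroup : LieGroup I ∞ G]
  nilpotent : (⊤ : Subgroup G).lowerCentralSeries k = ⊥
  /-- the discrete cocompact subgroup -/
  Γ : Subgroup G
  [discrete : DiscreteTopology Γ]
  [cocompact : CompactSpace (G ⧸ Γ)]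

attribute [instance] Nilmanifold.group Nilmanifold.topology Nilmanifold.t2
  Nilmanifold.secondCountable Nilmanifold.normedAddCommGroup Nilmanifold.normedSpace
  Nilmanifold.finiteDimensional Nilmanifold.topologyH Nilmanifold.boundaryless
  Nilmanifold.chartedSpace Nilmanifold.lieGroup Nilmanifold.discrete Nilmanifold.cocompact

/-- `ψ` is a `k`-step nilsequence: `ψ n = F (gⁿ • x)` for some `g ∈ G`, some point `x` and some
continuous `F : G ⧸ Γ → ℂ`, where `G` acts on `G ⧸ Γ` by left translation.
Sequences are indexed by the positive integers. -/
def IsNilsequence (k : ℕ) (ψ : ℕ+ → ℂ) : Prop :=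
  ∃ (X : Nilmanifold k) (g : X.G) (x : X.G ⧸ X.Γ) (F : C(X.G ⧸ X.Γ, ℂ)),
    ∀ n : ℕ+, ψ n = F (g ^ (n : ℕ) • x)

/-- `ψ` is a uniform limit of `k`-step nilsequences. -/
def IsUniformLimitNil (k : ℕ) (ψ : ℕ+ → ℂ) : Prop :=
  ∀ ε : ℝ, 0 < ε → ∃ φ : ℕ+ → ℂ, IsNilsequence k φ ∧ ∀ n : ℕ+, ‖ψ n - φ n‖ < ε

/-- An almost periodic sequence is a uniform limit of `1`-step nilsequences. -/
def IsAlmostPeriodicSeq (ψ : ℕ+ → ℂ) : Prop :=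
  IsUniformLimitNil 1 ψ

/-- `E = {r 1 < r 2 < ...}` is a `k`-step-`I₀` set: for every bounded complex sequence `b` there is
a uniform limit `ψ` of `k`-step nilsequences with `ψ (r n) = b n` for all `n`. -/
def IsStepI0 (k : ℕ) (E : Set ℕ+) : Prop :=
  ∃ r : ℕ+ → ℕ+, StrictMono r ∧ Set.range r = E ∧
    ∀ b : ℕ+ → ℂ, (∃ M : ℝ, ∀ n, ‖b n‖ ≤ M) →
      ∃ ψ : ℕ+ → ℂ, IsUniformLimitNil k ψ ∧ ∀ n, ψ (r n) = b n

/-- A strictly increasing sequence `s` of positive integers is lacunary if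
`inf_n s (n + 1) / s n > 1`. -/
def IsLacunarySeq (s : ℕ+ → ℕ+) : Prop :=
  StrictMono s ∧ ∃ q : ℝ, 1 < q ∧ ∀ n, q ≤ (s (n + 1) : ℝ) / (s n : ℝ)

/-- The set `{s n : n ≥ 1} ∪ {s n + n : n ≥ 1}`. -/
def shiftedUnion (s : ℕ+ → ℕ+) : Set ℕ+ :=
  Set.range s ∪ Set.range (fun n => s n + n)

-- Squaring turns step one into step two: if `A` is abelian, the powers of `(1, g, g)` in the
-- two-step group `SquareExt A` carry `g ^ n ^ 2` in their last coordinate. Hence `E` is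
-- `2`-step-`I₀` as soon as its set of squares is `1`-step-`I₀`.
--
-- For `E = {s n} ∪ {s n + n}`, step one fails because an almost periodic sequence has a uniform
-- almost period `m`, so it cannot separate `s m` from `s m + m` (`not_isStepI0_one_shiftedUnion`).
-- The squares do not have this defect: their gaps `(s n + n) ^ 2 - s n ^ 2 = 2 * n * s n + n ^ 2`
-- are unbounded and interlace with the `s n ^ 2` in one rapidly growing sequence. One character can
-- therefore approximate any unimodular data on the squares (`exists_circle_pow_near`), and
-- iterating on the error gives exact interpolation of bounded data
-- (`exists_isAlmostPeriodicSeq_eqOn`).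

attribute [local instance] ChartedSpace.ofDiscreteTopology

/-! ### The two-step group carrying the squares -/

/-- The semidirect product of `ℤ` with `A × A`, where `m : ℤ` acts by `(x, y) ↦ (x, y * x ^ (2 * m))`.
It is nilpotent of step two, and the powers of `(1, g, g)` are the elements `(n, g ^ n, g ^ n ^ 2)`. -/
def SquareExt (A : Type*) := ℤ × A × A

namespace SquareExt

variable {A : Type*}

/-- The element with the given coordinates. -/
def mk (m : ℤ) (x y : A) : SquareExt A := (m, x, y)

/-- The exponent. -/
def exp (p : SquareExt A) : ℤ := Prod.fst p

/-- The linear coordinate. -/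
def fst (p : SquareExt A) : A := Prod.fst (Prod.snd p)

/-- The quadratic coordinate. -/
def snd (p : SquareExt A) : A := Prod.snd (Prod.snd p)

@[simp] lemma exp_mk (m : ℤ) (x y : A) : (mk m x y).exp = m := rfl
@[simp] lemma fst_mk (m : ℤ) (x y : A) : (mk m x y).fst = x := rfl
@[simp] lemma snd_mk (m : ℤ) (x y : A) : (mk m x y).snd = y := rfl

@[ext]
lemma ext {p q : SquareExt A} (h : p.exp = q.exp) (h₁ : p.fst = q.fst) (h₂ : p.snd = q.snd) :
    p = q :=
  Prod.ext h (Prod.ext h₁ h₂)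

section Group

variable [CommGroup A]

instance : Mul (SquareExt A) :=
  ⟨fun p q => mk (p.exp + q.exp) (p.fst * q.fst) (p.snd * q.snd * q.fst ^ (2 * p.exp))⟩
instance : One (SquareExt A) := ⟨mk 0 1 1⟩
instance : Inv (SquareExt A) := ⟨fun p => mk (-p.exp) p.fst⁻¹ (p.snd⁻¹ * p.fst ^ (2 * p.exp))⟩

@[simp] lemma exp_mul (p q : SquareExt A) : (p * q).exp = p.exp + q.exp := rfl
@[simp] lemma fst_mul (p q : SquareExt A) : (p * q).fst = p.fst * q.fst := rfl
@[simp] lemma snd_mul (p q : SquareExt A) :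
    (p * q).snd = p.snd * q.snd * q.fst ^ (2 * p.exp) := rfl
@[simp] lemma exp_one : (1 : SquareExt A).exp = 0 := rfl
@[simp] lemma fst_one : (1 : SquareExt A).fst = 1 := rfl
@[simp] lemma snd_one : (1 : SquareExt A).snd = 1 := rfl
@[simp] lemma exp_inv (p : SquareExt A) : p⁻¹.exp = -p.exp := rfl
@[simp] lemma fst_inv (p : SquareExt A) : p⁻¹.fst = p.fst⁻¹ := rfl
@[simp] lemma snd_inv (p : SquareExt A) : p⁻¹.snd = p.snd⁻¹ * p.fst ^ (2 * p.exp) := rfl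

instance : Group (SquareExt A) :=
  Group.ofLeftAxioms
    (fun p q r => by
      ext
      · simp [add_assoc]
      · simp [mul_assoc]
      · simp only [snd_mul, fst_mul, exp_mul, mul_zpow, mul_add, zpow_add]
        simp only [mul_assoc, mul_left_comm, mul_comm])
    (fun p => by ext <;> simp)
    (fun p => by
      ext <;> simp [mul_assoc])

lemma mk_pow (g : A) (n : ℕ) : mk 1 g g ^ n = mk n (g ^ n) (g ^ n ^ 2) := by
  induction n with
  | zero => ext <;> simp
  | succ n ih =>
    rw [pow_succ, ih]
    ext
    · simp
    · simp [pow_succ]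
    · simp only [snd_mul, snd_mk, fst_mk, exp_mk]
      rw [← zpow_natCast, ← zpow_natCast, ← zpow_add_one, ← zpow_add]
      congr 1
      push_cast
      ring

/-- Commutators have exponent `0` and linear coordinate `1`, and such elements are central. -/
lemma lowerCentralSeries_two : (⊤ : Subgroup (SquareExt A)).lowerCentralSeries 2 = ⊥ := by
  have h1 : (⊤ : Subgroup (SquareExt A)).lowerCentralSeries 1 ≤ Subgroup.center _ := by
    rw [Subgroup.lowerCentralSeries_succ, Subgroup.lowerCentralSeries_zero,
      Subgroup.commutator_le]
    intro p _ q _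
    rw [Subgroup.mem_center_iff]
    intro r
    rw [commutatorElement_def]
    have he : (p * q * p⁻¹ * q⁻¹).exp = 0 := by simp
    have hf : (p * q * p⁻¹ * q⁻¹).fst = 1 := by simp
    generalize p * q * p⁻¹ * q⁻¹ = c at he hf
    ext
    · simp [he]
    · simp [hf]
    · simp [he, hf, mul_comm]
  rw [Subgroup.lowerCentralSeries_succ, Subgroup.commutator_eq_bot_iff_le_centralizer]
  refine h1.trans ?_
  rw [Subgroup.coe_top, Subgroup.centralizer_univ]

/-- The elements whose coordinates lie in `ℤ`, `Γ` and `Γ`. -/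
def lattice (Γ : Subgroup A) : Subgroup (SquareExt A) where
  carrier := {p | p.fst ∈ Γ ∧ p.snd ∈ Γ}
  mul_mem' hp hq := ⟨Γ.mul_mem hp.1 hq.1, Γ.mul_mem (Γ.mul_mem hp.2 hq.2) (Γ.zpow_mem hq.1 _)⟩
  one_mem' := ⟨Γ.one_mem, Γ.one_mem⟩
  inv_mem' hp := ⟨Γ.inv_mem hp.1, Γ.mul_mem (Γ.inv_mem hp.2) (Γ.zpow_mem hp.1 _)⟩

lemma mem_lattice {Γ : Subgroup A} {p : SquareExt A} :
    p ∈ lattice Γ ↔ p.fst ∈ Γ ∧ p.snd ∈ Γ := Iff.rfl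

end Group

section Topology

variable [TopologicalSpace A]

instance : TopologicalSpace (SquareExt A) := inferInstanceAs (TopologicalSpace (ℤ × A × A))

instance [T2Space A] : T2Space (SquareExt A) := inferInstanceAs (T2Space (ℤ × A × A))

instance [SecondCountableTopology A] : SecondCountableTopology (SquareExt A) :=
  inferInstanceAs (SecondCountableTopology (ℤ × A × A))

lemma continuous_exp : Continuous (exp : SquareExt A → ℤ) := _root_.continuous_fst

lemma continuous_fst : Continuous (fst : SquareExt A → A) :=
  _root_.continuous_fst.comp _root_.continuous_snd

lemma continuous_snd : Continuous (snd : SquareExt A → A) :=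
  _root_.continuous_snd.comp _root_.continuous_snd

lemma continuous_mk (m : ℤ) : Continuous fun p : A × A => mk m p.1 p.2 :=
  Continuous.prodMk_right m

lemma discreteTopology_lattice [CommGroup A] (Γ : Subgroup A) [DiscreteTopology Γ] :
    DiscreteTopology (lattice Γ) := by
  let f : lattice Γ → ℤ × Γ × Γ := fun p => (p.1.exp, ⟨p.1.fst, p.2.1⟩, ⟨p.1.snd, p.2.2⟩)
  have hf : Continuous f :=
    (continuous_exp.comp continuous_subtype_val).prodMk
      (((continuous_fst.comp continuous_subtype_val).subtype_mk _).prodMk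
        ((continuous_snd.comp continuous_subtype_val).subtype_mk _))
  refine DiscreteTopology.of_continuous_injective hf fun p q h => ?_
  simp only [f, Prod.mk.injEq, Subtype.mk.injEq] at h
  exact Subtype.ext (SquareExt.ext h.1 h.2.1 h.2.2)

/-- The lattice contains every exponent, so each coset has a representative of exponent `0` and the
quotient is a continuous image of `(A ⧸ Γ) × (A ⧸ Γ)`. -/
lemma compactSpace_quotient_lattice [CommGroup A] [IsTopologicalGroup A] (Γ : Subgroup A)
    [CompactSpace (A ⧸ Γ)] : CompactSpace (SquareExt A ⧸ lattice Γ) := by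
  have hq : IsOpenQuotientMap (Prod.map (QuotientGroup.mk : A → A ⧸ Γ)
      (QuotientGroup.mk : A → A ⧸ Γ)) :=
    QuotientGroup.isOpenQuotientMap_mk.prodMap QuotientGroup.isOpenQuotientMap_mk
  let f : A × A → SquareExt A ⧸ lattice Γ := fun p => QuotientGroup.mk (mk 0 p.1 p.2)
  have hf : Continuous f := continuous_quot_mk.comp (continuous_mk 0)
  have hfac : ∀ p p' : A × A, Prod.map (QuotientGroup.mk : A → A ⧸ Γ)
      (QuotientGroup.mk : A → A ⧸ Γ) p = Prod.map QuotientGroup.mk QuotientGroup.mk p' →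
      f p = f p' := by
    rintro ⟨x, y⟩ ⟨x', y'⟩ h
    simp only [Prod.map_apply, Prod.mk.injEq, QuotientGroup.eq] at h
    refine QuotientGroup.eq.2 (mem_lattice.2 ⟨?_, ?_⟩)
    · simpa using h.1
    · simpa using h.2
  have hs : Function.Surjective f := by
    intro p
    induction p using QuotientGroup.induction_on with
    | H p =>
      refine ⟨(p.fst, p.snd), QuotientGroup.eq.2 (mem_lattice.2 ⟨?_, ?_⟩)⟩
      · simp
      · simp
  let F : (A ⧸ Γ) × (A ⧸ Γ) → SquareExt A ⧸ lattice Γ :=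
    Function.extend (Prod.map QuotientGroup.mk QuotientGroup.mk) f fun _ => QuotientGroup.mk 1
  have hF : ∀ p, F (Prod.map QuotientGroup.mk QuotientGroup.mk p) = f p := fun p =>
    Function.FactorsThrough.extend_apply (fun a b => hfac a b) _ p
  have hFc : Continuous F := by
    rw [← hq.continuous_comp_iff]
    exact hf.congr fun p => (hF p).symm
  have hFs : Function.Surjective F := fun y => by
    obtain ⟨p, rfl⟩ := hs y
    exact ⟨_, hF p⟩
  exact hFs.compactSpace hFc

end Topology

section Manifold

variable {V H : Type*} [NormedAddCommGroup V] [NormedSpace ℝ V] [TopologicalSpace H]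
  {I : ModelWithCorners ℝ V H} [TopologicalSpace A] [ChartedSpace H A]

instance : ChartedSpace (ModelProd PUnit (ModelProd H H)) (SquareExt A) :=
  inferInstanceAs (ChartedSpace (ModelProd PUnit (ModelProd H H)) (ℤ × A × A))

variable (I) in
/-- The model with corners of the manifold `SquareExt A`. -/
noncomputable abbrev model : ModelWithCorners ℝ (PUnit × V × V) (ModelProd PUnit (ModelProd H H)) :=
  𝓘(ℝ, PUnit).prod (I.prod I)

lemma contMDiff_fst : ContMDiff (model I) I ∞ (fst : SquareExt A → A) :=
  _root_.contMDiff_fst.comp _root_.contMDiff_snd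

lemma contMDiff_snd : ContMDiff (model I) I ∞ (snd : SquareExt A → A) :=
  _root_.contMDiff_snd.comp _root_.contMDiff_snd

lemma contMDiffAt_mk {V' H' M : Type*} [NormedAddCommGroup V'] [NormedSpace ℝ V']
    [TopologicalSpace H'] {I' : ModelWithCorners ℝ V' H'} [TopologicalSpace M] [ChartedSpace H' M]
    {m : ℤ} {f g : M → A} {a : M} (hf : ContMDiffAt I' I ∞ f a) (hg : ContMDiffAt I' I ∞ g a) :
    ContMDiffAt I' (model I) ∞ (fun p => mk m (f p) (g p)) a :=
  ContMDiffAt.prodMk (contMDiffAt_const (c := m)) (hf.prodMk hg)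

variable [CommGroup A] [LieGroup I ∞ A]

lemma contMDiff_zpow (m : ℤ) : ContMDiff I I ∞ fun x : A => x ^ m := by
  cases m with
  | ofNat n => simpa using contMDiff_pow (I := I) (n := ∞) n
  | negSucc n => simpa using! (contMDiff_pow (I := I) (n := ∞) (n + 1)).inv

instance : LieGroup (model I) ∞ (SquareExt A) where
  toIsManifold :=
    haveI : IsManifold 𝓘(ℝ, PUnit) ∞ ℤ := IsManifold.of_discreteTopology _
    inferInstanceAs (IsManifold (model I) ∞ (ℤ × A × A))
  contMDiff_mul := by
    rintro ⟨p, q⟩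
    have h₁ : ContMDiff ((model I).prod (model I)) I ∞
        fun z : SquareExt A × SquareExt A => z.1.fst := contMDiff_fst.comp _root_.contMDiff_fst
    have h₂ : ContMDiff ((model I).prod (model I)) I ∞
        fun z : SquareExt A × SquareExt A => z.2.fst := contMDiff_fst.comp _root_.contMDiff_snd
    have h₃ : ContMDiff ((model I).prod (model I)) I ∞
        fun z : SquareExt A × SquareExt A => z.1.snd := contMDiff_snd.comp _root_.contMDiff_fst
    have h₄ : ContMDiff ((model I).prod (model I)) I ∞
        fun z : SquareExt A × SquareExt A => z.2.snd := contMDiff_snd.comp _root_.contMDiff_snd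
    refine (contMDiffAt_mk (m := p.exp + q.exp) ((h₁.mul h₂) (p, q))
      (((h₃.mul h₄).mul ((contMDiff_zpow (2 * p.exp)).comp h₂)) (p, q))).congr_of_eventuallyEq ?_
    -- The exponents are locally constant, so near `(p, q)` the twist is a power map with fixed
    -- exponent, hence smooth.
    have h₅ := (continuous_exp (A := A)).comp (_root_.continuous_fst (Y := SquareExt A))
    have h₆ := (continuous_exp (A := A)).comp (_root_.continuous_snd (X := SquareExt A))
    filter_upwards [(h₅.tendsto (p, q)).eventually_mem (isOpen_discrete {p.exp} |>.mem_nhds rfl),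
      (h₆.tendsto (p, q)).eventually_mem (isOpen_discrete {q.exp} |>.mem_nhds rfl)] with z hz hz'
    simp only [Function.comp_apply, Set.mem_singleton_iff] at hz hz'
    ext
    · simp [hz, hz']
    · simp
    · simp [hz]
  contMDiff_inv := by
    intro p
    refine (contMDiffAt_mk (m := -p.exp) ((contMDiff_fst (I := I)).inv p)
      (((contMDiff_snd (I := I)).inv.mul ((contMDiff_zpow (2 * p.exp)).comp contMDiff_fst)) p)
      ).congr_of_eventuallyEq ?_
    filter_upwards [((continuous_exp (A := A)).tendsto p).eventually_mem
      (isOpen_discrete {p.exp} |>.mem_nhds rfl)] with z hz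
    simp only [Set.mem_singleton_iff] at hz
    ext
    · simp [hz]
    · simp
    · simp [hz]

end Manifold

end SquareExt

/-! ### Almost periodic sequences along the squares -/

namespace Nilmanifold

/-- The nilmanifold of step two whose orbits carry the sequences `g ^ n ^ 2`. -/
noncomputable def squareExt {A V H : Type} [CommGroup A] [TopologicalSpace A] [T2Space A]
    [SecondCountableTopology A] [NormedAddCommGroup V] [NormedSpace ℝ V] [FiniteDimensional ℝ V]
    [TopologicalSpace H] (I : ModelWithCorners ℝ V H) [I.Boundaryless] [ChartedSpace H A]
    [LieGroup I ∞ A] (Γ : Subgroup A) [DiscreteTopology Γ] [CompactSpace (A ⧸ Γ)] :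
    Nilmanifold 2 :=
  haveI := topologicalGroup_of_lieGroup I ∞ (G := A)
  { G := SquareExt A
    V := PUnit × V × V
    H := ModelProd PUnit (ModelProd H H)
    I := SquareExt.model I
    nilpotent := SquareExt.lowerCentralSeries_two
    Γ := SquareExt.lattice Γ
    discrete := SquareExt.discreteTopology_lattice Γ
    cocompact := SquareExt.compactSpace_quotient_lattice Γ }

lemma mul_comm_of_step_one (X : Nilmanifold 1) (a b : X.G) : a * b = b * a := by
  have h := X.nilpotent
  rw [Subgroup.top_lowerCentralSeries_one, commutator_eq_bot_iff_center_eq_top] at h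
  exact (Subgroup.mem_center_iff.1 (h ▸ Subgroup.mem_top a) b).symm

end Nilmanifold

theorem IsNilsequence.comp_sq {φ : ℕ+ → ℂ} (hφ : IsNilsequence 1 φ) :
    IsNilsequence 2 fun n => φ (n ^ 2) := by
  obtain ⟨X, g, x, F, hF⟩ := hφ
  let _ : CommGroup X.G := { X.group with mul_comm := X.mul_comm_of_step_one }
  obtain ⟨a, rfl⟩ := QuotientGroup.mk_surjective x
  have hinv : ∀ p q : SquareExt X.G, QuotientGroup.leftRel (SquareExt.lattice X.Γ) p q →
      F (QuotientGroup.mk p.snd) = F (QuotientGroup.mk q.snd) := by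
    intro p q h
    rw [QuotientGroup.leftRel_apply, SquareExt.mem_lattice] at h
    congr 1
    rw [QuotientGroup.eq]
    -- The last coordinate of `p⁻¹ * q` is `p.snd⁻¹ * q.snd` up to the twist `(p.fst⁻¹ * q.fst) ^
    -- (-2 * p.exp)`, which lies in `Γ`.
    have := X.Γ.mul_mem h.2 (X.Γ.zpow_mem h.1 (2 * p.exp))
    convert this using 1
    simp only [SquareExt.snd_mul, SquareExt.fst_mul, SquareExt.snd_inv, SquareExt.fst_inv,
      SquareExt.exp_inv, mul_zpow, mul_neg, zpow_neg, inv_zpow]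
    rw [mul_right_comm p.snd⁻¹, mul_assoc, mul_assoc, mul_left_comm _ _ (q.fst ^ (2 * p.exp))]
    simp
  -- The base point has linear coordinate `1`, so translating it creates no cross term.
  refine ⟨Nilmanifold.squareExt X.I X.Γ, SquareExt.mk 1 g g, QuotientGroup.mk (SquareExt.mk 0 1 a),
    ⟨Quotient.lift (fun p : SquareExt X.G => F (QuotientGroup.mk p.snd)) hinv,
      Continuous.quotient_lift (F.continuous.comp
        (continuous_quot_mk.comp SquareExt.continuous_snd)) hinv⟩, fun n => ?_⟩
  refine (hF (n ^ 2)).trans ?_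
  rw [PNat.pow_coe]
  have h : SquareExt.mk 1 g g ^ (n : ℕ) • (QuotientGroup.mk (SquareExt.mk 0 1 a) :
      SquareExt X.G ⧸ SquareExt.lattice X.Γ) =
      QuotientGroup.mk (SquareExt.mk n (g ^ (n : ℕ)) (g ^ (n : ℕ) ^ 2 * a)) := by
    rw [SquareExt.mk_pow, MulAction.Quotient.smul_mk]
    congr 1
    ext <;> simp
  exact congrArg (Quotient.lift (fun p : SquareExt X.G => F (QuotientGroup.mk p.snd)) hinv) h.symm

theorem IsAlmostPeriodicSeq.comp_sq {θ : ℕ+ → ℂ} (hθ : IsAlmostPeriodicSeq θ) :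
    IsUniformLimitNil 2 fun n => θ (n ^ 2) := fun ε hε => by
  obtain ⟨φ, hφ, h⟩ := hθ ε hε
  exact ⟨_, hφ.comp_sq, fun n => h (n ^ 2)⟩

/-! ### Products, the circle, and linear combinations of nilsequences -/

namespace Nilmanifold

variable {k : ℕ}

instance isTopologicalGroup (X : Nilmanifold k) : IsTopologicalGroup X.G :=
  topologicalGroup_of_lieGroup X.I ∞

/-- The product of two nilmanifolds. -/
noncomputable def prod (X Y : Nilmanifold k) : Nilmanifold k where
  G := X.G × Y.G
  V := X.V × Y.V
  H := ModelProd X.H Y.H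
  I := X.I.prod Y.I
  nilpotent := by
    rw [Subgroup.top_lowerCentralSeries_prod, X.nilpotent, Y.nilpotent, Subgroup.bot_prod_bot]
  Γ := X.Γ.prod Y.Γ
  discrete := by
    let f : X.Γ.prod Y.Γ → X.Γ × Y.Γ := fun p => (⟨p.1.1, p.2.1⟩, ⟨p.1.2, p.2.2⟩)
    have hf : Continuous f :=
      ((continuous_fst.comp continuous_subtype_val).subtype_mk _).prodMk
        ((continuous_snd.comp continuous_subtype_val).subtype_mk _)
    refine DiscreteTopology.of_continuous_injective hf fun p q h => ?_
    simp only [f, Prod.mk.injEq, Subtype.mk.injEq] at h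
    exact Subtype.ext (Prod.ext h.1 h.2)
  cocompact := by
    have hq : IsOpenQuotientMap (Prod.map (QuotientGroup.mk : X.G → X.G ⧸ X.Γ)
        (QuotientGroup.mk : Y.G → Y.G ⧸ Y.Γ)) :=
      QuotientGroup.isOpenQuotientMap_mk.prodMap QuotientGroup.isOpenQuotientMap_mk
    let f : X.G × Y.G → (X.G × Y.G) ⧸ X.Γ.prod Y.Γ := QuotientGroup.mk
    have hfac : Function.FactorsThrough f (Prod.map (QuotientGroup.mk : X.G → X.G ⧸ X.Γ)
        (QuotientGroup.mk : Y.G → Y.G ⧸ Y.Γ)) := by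
      rintro ⟨x, y⟩ ⟨x', y'⟩ h
      simp only [Prod.map_apply, Prod.mk.injEq, QuotientGroup.eq] at h
      exact QuotientGroup.eq.2 h
    let F : (X.G ⧸ X.Γ) × (Y.G ⧸ Y.Γ) → (X.G × Y.G) ⧸ X.Γ.prod Y.Γ :=
      Function.extend (Prod.map QuotientGroup.mk QuotientGroup.mk) f fun _ => QuotientGroup.mk 1
    have hF : ∀ p, F (Prod.map QuotientGroup.mk QuotientGroup.mk p) = f p := fun p =>
      hfac.extend_apply _ p
    have hFc : Continuous F := by
      rw [← hq.continuous_comp_iff]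
      exact (continuous_quot_mk : Continuous f).congr fun p => (hF p).symm
    have hFs : Function.Surjective F := fun y => by
      obtain ⟨p, rfl⟩ := QuotientGroup.mk_surjective y
      exact ⟨_, hF p⟩
    exact hFs.compactSpace hFc

/-- The circle. -/
noncomputable def circle : Nilmanifold 1 where
  G := Circle
  V := EuclideanSpace ℝ (Fin 1)
  H := EuclideanSpace ℝ (Fin 1)
  I := 𝓡 1
  nilpotent := Subgroup.lowerCentralSeries_one_eq_bot_iff.2 inferInstance
  Γ := ⊥

end Nilmanifold

namespace IsNilsequence

variable {k : ℕ} {φ φ' : ℕ+ → ℂ}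

theorem add (hφ : IsNilsequence k φ) (hφ' : IsNilsequence k φ') :
    IsNilsequence k fun n => φ n + φ' n := by
  obtain ⟨X, g, x, F, hF⟩ := hφ
  obtain ⟨X', g', x', F', hF'⟩ := hφ'
  obtain ⟨a, rfl⟩ := QuotientGroup.mk_surjective x
  obtain ⟨a', rfl⟩ := QuotientGroup.mk_surjective x'
  let f : X.G × X'.G → ℂ := fun p => F (QuotientGroup.mk p.1) + F' (QuotientGroup.mk p.2)
  have hf : Continuous f :=
    (F.continuous.comp (continuous_quot_mk.comp continuous_fst)).add
      (F'.continuous.comp (continuous_quot_mk.comp continuous_snd))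
  have hinv : ∀ p q : X.G × X'.G, QuotientGroup.leftRel (X.Γ.prod X'.Γ) p q → f p = f q := by
    intro p q h
    rw [QuotientGroup.leftRel_apply] at h
    exact congrArg₂ (fun u v => F u + F' v) (QuotientGroup.eq.2 h.1) (QuotientGroup.eq.2 h.2)
  refine ⟨X.prod X', (g, g'), QuotientGroup.mk (a, a'),
    ⟨Quotient.lift f hinv, hf.quotient_lift hinv⟩, fun n => ?_⟩
  exact congrArg₂ (· + ·) (hF n) (hF' n)

theorem const_mul (hφ : IsNilsequence k φ) (c : ℂ) : IsNilsequence k fun n => c * φ n := by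
  obtain ⟨X, g, x, F, hF⟩ := hφ
  exact ⟨X, g, x, c • F, fun n => by simp [hF]⟩

theorem circle_pow (z : Circle) : IsNilsequence 1 fun n => ((z ^ (n : ℕ) : Circle) : ℂ) := by
  have hinv : ∀ p q : Circle, QuotientGroup.leftRel (⊥ : Subgroup Circle) p q →
      (p : ℂ) = q := by
    intro p q h
    rw [QuotientGroup.leftRel_apply, Subgroup.mem_bot, inv_mul_eq_one] at h
    rw [h]
  refine ⟨Nilmanifold.circle, z, QuotientGroup.mk (1 : Circle),
    ⟨Quotient.lift (fun p : Circle => (p : ℂ)) hinv,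
      (by fun_prop : Continuous fun p : Circle => (p : ℂ)).quotient_lift hinv⟩,
    fun n => ?_⟩
  change _ = ((z ^ (n : ℕ) * 1 : Circle) : ℂ)
  rw [mul_one]

theorem sum_range {φ : ℕ → ℕ+ → ℂ} (hφ : ∀ j, IsNilsequence 1 (φ j)) (K : ℕ) :
    IsNilsequence 1 fun n => ∑ j ∈ Finset.range K, φ j n := by
  induction K with
  | zero => simpa using (hφ 0).const_mul 0
  | succ K ih => simpa only [Finset.sum_range_succ] using ih.add (hφ K)

/-! ### Almost periods and the failure of step one -/

/-- A one-step nilsequence has an almost period. -/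
theorem exists_norm_add_sub_lt (hφ : IsNilsequence 1 φ) {ε : ℝ} (hε : 0 < ε) :
    ∃ m : ℕ+, ∀ n, ‖φ (n + m) - φ n‖ < ε := by
  obtain ⟨X, g, x, F, hF⟩ := hφ
  let T : X.G → C(X.G ⧸ X.Γ, ℂ) :=
    ContinuousMap.curry ⟨fun p : X.G × (X.G ⧸ X.Γ) => F (p.1 • p.2),
      F.continuous.comp continuous_smul⟩
  have hT : Continuous T := ContinuousMap.continuous _
  have hTa : ∀ h y, T h y = F (h • y) := fun _ _ => rfl
  -- As `G` is commutative, translation by `Γ` acts trivially on `G ⧸ Γ`. So `T` factors through the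
  -- compact quotient and the translates of `F` form a compact set in the uniform norm.
  have hinv : ∀ p q : X.G, QuotientGroup.leftRel X.Γ p q → T p = T q := by
    intro p q h
    rw [QuotientGroup.leftRel_apply] at h
    ext y
    obtain ⟨a, rfl⟩ := QuotientGroup.mk_surjective y
    rw [hTa, hTa, MulAction.Quotient.smul_coe, MulAction.Quotient.smul_coe]
    congr 1
    rw [QuotientGroup.eq]
    convert h using 1
    simp only [smul_eq_mul]
    rw [X.mul_comm_of_step_one q a, mul_inv_rev, X.mul_comm_of_step_one a⁻¹]
    group
  have hc : IsCompact (Set.range T) := by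
    have h := isCompact_range (X := X.G ⧸ X.Γ) (hT.quotient_lift hinv)
    convert h using 1
    exact (QuotientGroup.mk_surjective (s := X.Γ).range_comp (Quotient.lift T hinv))
  obtain ⟨G, -, i, hi, hG⟩ := hc.tendsto_subseq (x := fun n : ℕ => T (g ^ n))
    fun n => Set.mem_range_self _
  obtain ⟨N, hN⟩ := Metric.cauchySeq_iff'.1 hG.cauchySeq ε hε
  have hlt : i N < i (N + 1) := hi N.lt_succ_self
  obtain ⟨m, hm⟩ : ∃ m : ℕ+, (m : ℕ) = i (N + 1) - i N := ⟨⟨_, Nat.sub_pos_of_lt hlt⟩, rfl⟩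
  refine ⟨m, fun n => ?_⟩
  -- Two powers of `g` translate `F` to uniformly close functions; evaluating at a shifted point
  -- makes their exponent difference an almost period.
  have h := (ContinuousMap.dist_apply_le_dist ((g ^ (i N))⁻¹ • g ^ (n : ℕ) • x)).trans_lt
    (hN (N + 1) N.le_succ)
  simp only [Function.comp_apply, hTa, smul_inv_smul, dist_eq_norm] at h
  rw [smul_smul, smul_smul, ← pow_sub _ hlt.le, ← pow_add] at h
  rw [hF, hF, PNat.add_coe, hm, add_comm]
  exact h

end IsNilsequence

theorem IsAlmostPeriodicSeq.exists_norm_add_sub_lt {ψ : ℕ+ → ℂ} (hψ : IsAlmostPeriodicSeq ψ)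
    {ε : ℝ} (hε : 0 < ε) : ∃ m : ℕ+, ∀ n, ‖ψ (n + m) - ψ n‖ < ε := by
  obtain ⟨φ, hφ, h⟩ := hψ (ε / 3) (by positivity)
  obtain ⟨m, hm⟩ := hφ.exists_norm_add_sub_lt (ε := ε / 3) (by positivity)
  refine ⟨m, fun n => ?_⟩
  have h₁ := h n
  rw [norm_sub_rev] at h₁
  calc ‖ψ (n + m) - ψ n‖
      = ‖(ψ (n + m) - φ (n + m)) + (φ (n + m) - φ n) + (φ n - ψ n)‖ := by congr 1; ring
    _ ≤ _ := norm_add₃_le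
    _ < ε := by linarith [h (n + m), hm n]

/-- The data are `0` on `s n` and `1` on `s n + n`; an almost period `m` for `ε = 1` contradicts
them at `s m`. -/
theorem not_isStepI0_one_shiftedUnion {s : ℕ+ → ℕ+} (hs : ∀ n m, s n ≠ s m + m) :
    ¬ IsStepI0 1 (shiftedUnion s) := by
  classical
  rintro ⟨r, -, hrE, hr⟩
  obtain ⟨ψ, hψ, h⟩ := hr (fun n => if r n ∈ Set.range s then 0 else 1)
    ⟨1, fun n => by split_ifs <;> simp⟩
  obtain ⟨m, hm⟩ := IsAlmostPeriodicSeq.exists_norm_add_sub_lt hψ one_pos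
  obtain ⟨i, hi⟩ : s m ∈ Set.range r := hrE ▸ Or.inl ⟨m, rfl⟩
  obtain ⟨j, hj⟩ : s m + m ∈ Set.range r := hrE ▸ Or.inr ⟨m, rfl⟩
  have h₀ := h i
  have h₁ := h j
  rw [hi, if_pos (Set.mem_range_self m)] at h₀
  rw [hj, if_neg (by rintro ⟨n, hn⟩; exact hs n m hn)] at h₁
  simpa [h₀, h₁] using hm (s m)

/-! ### From approximation by characters to exact interpolation -/

/-- Write `‖b‖ = cos t`; then `b` is the midpoint of the unit vectors with angles `arg b ± t`. -/
lemma Circle.exists_eq_add_div_two {b : ℂ} (hb : ‖b‖ ≤ 1) :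
    ∃ u v : Circle, b = (u + v : ℂ) / 2 := by
  refine ⟨Circle.exp (Complex.arg b + Real.arccos ‖b‖),
    Circle.exp (Complex.arg b - Real.arccos ‖b‖), ?_⟩
  have h : Complex.cos (Real.arccos ‖b‖ : ℝ) = ‖b‖ := by
    rw [← Complex.ofReal_cos, Real.cos_arccos (by linarith [norm_nonneg b]) hb]
  simp only [Circle.coe_exp, Complex.ofReal_add, Complex.ofReal_sub, add_mul, sub_mul,
    Complex.exp_add, Complex.exp_sub]
  conv_lhs => rw [← Complex.norm_mul_exp_arg_mul_I b, ← h, Complex.cos]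
  rw [div_eq_mul_inv (Complex.exp _) (Complex.exp _), ← Complex.exp_neg, neg_mul]
  ring

/-- If characters approximate all unimodular functions on `Q` up to `1 / 2`, then almost periodic
sequences interpolate all bounded functions on `Q`. -/
theorem exists_isAlmostPeriodicSeq_eqOn {Q : Set ℕ+}
    (hQ : ∀ τ : ℕ+ → Circle, ∃ z : Circle, ∀ q ∈ Q,
      ‖((z ^ (q : ℕ) : Circle) : ℂ) - τ q‖ ≤ 1 / 2)
    {b : ℕ+ → ℂ} {M : ℝ} (hb : ∀ n, ‖b n‖ ≤ M) :
    ∃ ψ, IsAlmostPeriodicSeq ψ ∧ ∀ q ∈ Q, ψ q = b q := by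
  -- The mean of two characters is within `1 / 2` of `c` on `Q`, so the doubled error is again
  -- bounded by `1` and the step can be iterated.
  have step : ∀ c : {c : ℕ+ → ℂ // ∀ q ∈ Q, ‖c q‖ ≤ 1}, ∃ ψ : ℕ+ → ℂ, IsNilsequence 1 ψ ∧
      (∀ n, ‖ψ n‖ ≤ 1) ∧ ∀ q ∈ Q, ‖2 * (c.1 q - ψ q)‖ ≤ 1 := by
    rintro ⟨c, hc⟩
    have huv : ∀ n, ∃ w : Circle × Circle, n ∈ Q → c n = (w.1 + w.2 : ℂ) / 2 := by
      intro n
      by_cases hn : n ∈ Q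
      · obtain ⟨u, v, h⟩ := Circle.exists_eq_add_div_two (hc n hn)
        exact ⟨(u, v), fun _ => h⟩
      · exact ⟨1, fun h => absurd h hn⟩
    choose w hw using huv
    obtain ⟨y, hy⟩ := hQ fun n => (w n).1
    obtain ⟨z, hz⟩ := hQ fun n => (w n).2
    refine ⟨_, ((IsNilsequence.circle_pow y).add (IsNilsequence.circle_pow z)).const_mul (1 / 2),
      fun n => ?_, fun q hq => ?_⟩
    · have := norm_add_le ((y ^ (n : ℕ) : Circle) : ℂ) ((z ^ (n : ℕ) : Circle) : ℂ)
      simp only [Circle.norm_coe] at this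
      rw [norm_mul, show ‖(1 / 2 : ℂ)‖ = 1 / 2 by norm_num]
      linarith
    · simp only [hw q hq]
      calc _ = ‖-(((y ^ (q : ℕ) : Circle) : ℂ) - (w q).1) - (((z ^ (q : ℕ) : Circle) : ℂ) -
            (w q).2)‖ := by congr 1; ring
        _ ≤ _ := norm_sub_le _ _
        _ ≤ 1 := by rw [norm_neg]; linarith [hy q hq, hz q hq]
  choose ψ hψ hψ₁ hψ₂ using step
  have hM : 0 ≤ M := (norm_nonneg _).trans (hb 1)
  let next : {c : ℕ+ → ℂ // ∀ q ∈ Q, ‖c q‖ ≤ 1} → {c : ℕ+ → ℂ // ∀ q ∈ Q, ‖c q‖ ≤ 1} :=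
    fun c => ⟨fun n => 2 * (c.1 n - ψ c n), hψ₂ c⟩
  let c₀ : {c : ℕ+ → ℂ // ∀ q ∈ Q, ‖c q‖ ≤ 1} := ⟨fun n => b n / M, fun q _ => by
    rw [norm_div, Complex.norm_real, Real.norm_of_nonneg hM]
    exact div_le_one_of_le₀ (hb q) hM⟩
  let c : ℕ → {c : ℕ+ → ℂ // ∀ q ∈ Q, ‖c q‖ ≤ 1} := fun j => next^[j] c₀
  have hcs : ∀ j, c (j + 1) = next (c j) := fun j => Function.iterate_succ_apply' _ _ _
  let f : ℕ → ℕ+ → ℂ := fun j n => M * (1 / 2) ^ j * ψ (c j) n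
  have hf : ∀ j n, ‖f j n‖ ≤ M * (1 / 2) ^ j := fun j n => by
    simp only [f, norm_mul, norm_pow, Complex.norm_real, Real.norm_of_nonneg hM]
    norm_num
    exact mul_le_of_le_one_right (by positivity) (hψ₁ (c j) n)
  have hsum : ∀ n, Summable fun j => f j n := fun n =>
    Summable.of_norm_bounded (summable_geometric_two.mul_left M) fun j => hf j n
  have hpart : ∀ q ∈ Q, ∀ K, ∑ j ∈ Finset.range K, f j q = b q - M * (1 / 2) ^ K * (c K).1 q := by
    intro q _ K
    induction K with
    | zero =>
      -- If `M = 0`, the quotient `b n / M` is `0` by convention, and `b` vanishes as well.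
      rcases hM.eq_or_lt with rfl | hM
      · have : b q = 0 := norm_le_zero_iff.1 (hb q)
        simp [this]
      · have : (M : ℂ) ≠ 0 := by exact_mod_cast hM.ne'
        simp [c, c₀]
        field_simp
        simp
    | succ K ih =>
      rw [Finset.sum_range_succ, ih, hcs]
      simp only [f, next]
      ring
  refine ⟨fun n => ∑' j, f j n, fun ε hε => ?_, fun q hq => ?_⟩
  · obtain ⟨K, hK⟩ := exists_pow_lt_of_lt_one (x := ε / (2 * M + 1)) (y := 1 / 2)
      (by positivity) (by norm_num)
    refine ⟨_, IsNilsequence.sum_range (fun j => (hψ (c j)).const_mul (M * (1 / 2) ^ j)) K,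
      fun n => ?_⟩
    have h := norm_sub_le_of_geometric_bound_of_hasSum (by norm_num) (fun j => hf j n)
      (hsum n).hasSum K
    rw [norm_sub_rev] at h
    refine h.trans_lt ?_
    rw [show (1 - 1 / 2 : ℝ) = 1 / 2 by norm_num, div_div_eq_mul_div, div_one]
    rw [lt_div_iff₀ (by positivity)] at hK
    have : 0 < (1 / 2 : ℝ) ^ K := by positivity
    linarith
  · refine tendsto_nhds_unique (hsum q).hasSum.tendsto_sum_nat ?_
    simp only [hpart q hq]
    have h : Filter.Tendsto (fun K => M * (1 / 2) ^ K * (c K).1 q) Filter.atTop (nhds (0 : ℂ)) := by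
      refine squeeze_zero_norm (a := fun K => M * (1 / 2 : ℝ) ^ K) (fun K => ?_) ?_
      · simp only [norm_mul, norm_pow, Complex.norm_real, Real.norm_of_nonneg hM]
        norm_num
        exact mul_le_of_le_one_right (by positivity) ((c K).2 q hq)
      · simpa using (tendsto_pow_atTop_nhds_zero_of_lt_one (r := (1 / 2 : ℝ)) (by norm_num)
          (by norm_num)).const_mul M
    simpa using h.const_sub (b q)

/-- Data indexed by the enumeration of `E` are transported to data on the integers themselves. -/
theorem isStepI0_of_forall_exists {k : ℕ} {E : Set ℕ+} (hE : E.Infinite)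
    (h : ∀ (b : ℕ+ → ℂ) (M : ℝ), (∀ n, ‖b n‖ ≤ M) →
      ∃ ψ, IsUniformLimitNil k ψ ∧ ∀ q ∈ E, ψ q = b q) : IsStepI0 k E := by
  let p : ℕ → Prop := fun m => ∃ q ∈ E, (q : ℕ) = m
  have hp : (Set.ofPred p).Infinite := hE.image PNat.coe_injective.injOn
  let r : ℕ+ → ℕ+ := fun n => (Nat.nth p n.natPred).toPNat'
  have hrp : ∀ n : ℕ+, ∃ q ∈ E, (q : ℕ) = Nat.nth p n.natPred := fun n =>
    Nat.nth_mem_of_infinite hp _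
  have hr : ∀ n, (r n : ℕ) = Nat.nth p n.natPred := fun n => by
    obtain ⟨q, -, h⟩ := hrp n
    simp only [r, ← h, PNat.coe_toPNat']
  have hrE : ∀ n, r n ∈ E := fun n => by
    obtain ⟨q, hq, h⟩ := hrp n
    rwa [PNat.coe_injective ((hr n).trans h.symm)]
  have hmono : StrictMono r := fun m n hmn => by
    rw [← PNat.coe_lt_coe, hr, hr]
    exact Nat.nth_strictMono hp (PNat.natPred_strictMono hmn)
  refine ⟨r, hmono, ?_, fun b ⟨M, hM⟩ => ?_⟩
  · refine Set.Subset.antisymm (Set.range_subset_iff.2 hrE) fun q hq => ?_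
    obtain ⟨j, hj⟩ : (q : ℕ) ∈ Set.range (Nat.nth p) := by
      rw [Nat.range_nth_of_infinite hp]
      exact ⟨q, hq, rfl⟩
    refine ⟨j.succPNat, PNat.coe_injective ?_⟩
    rw [hr, Nat.natPred_succPNat, hj]
  · obtain ⟨ψ, hψ, hψb⟩ := h (fun q => b (Function.invFun r q)) M fun n => hM _
    exact ⟨ψ, hψ, fun n => by
      rw [hψb _ (hrE n), Function.leftInverse_invFun hmono.injective]⟩

/-! ### Choosing an angle by nested intervals -/

-- The solutions are spaced `2 * π / q` apart, so one lies within `π / q ≤ 4 / q` of `a`.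
open Real in
lemma exists_circle_exp_mul_eq (a : ℝ) {q : ℝ} (hq : 0 < q) (u : Circle) :
    ∃ a', |a' - a| ≤ 4 / q ∧ Circle.exp (q * a') = u := by
  obtain ⟨t, rfl⟩ := Circle.exp_surjective u
  refine ⟨(t + round ((q * a - t) / (2 * π)) * (2 * π)) / q, ?_, ?_⟩
  · have h := abs_sub_round ((q * a - t) / (2 * π))
    have hpi := pi_pos
    have e : (t + round ((q * a - t) / (2 * π)) * (2 * π)) / q - a =
        -(((q * a - t) / (2 * π) - round ((q * a - t) / (2 * π))) * (2 * π) / q) := by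
      field_simp
      ring
    rw [e, abs_neg, abs_div, abs_mul, abs_of_pos hq, abs_of_pos (by positivity : 0 < 2 * π)]
    gcongr
    nlinarith [pi_le_four]
  · rw [mul_div_cancel₀ _ hq.ne', Circle.exp_add, Circle.exp_int_mul_two_pi, mul_one]

lemma norm_circle_exp_sub_le (x y : ℝ) :
    ‖(Circle.exp x : ℂ) - Circle.exp y‖ ≤ |x - y| := by
  have h : (Circle.exp x : ℂ) - Circle.exp y =
      Circle.exp y * (Complex.exp (Complex.I * (x - y : ℝ)) - 1) := by
    simp only [Circle.coe_exp, mul_sub, ← Complex.exp_add, mul_one]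
    congr 2
    push_cast
    ring
  rw [h, norm_mul, Circle.norm_coe, one_mul]
  exact Real.norm_exp_I_mul_ofReal_sub_one_le

/-- Simultaneous approximation along two interlaced rapidly growing sequences. -/
theorem exists_circle_pow_near {d q : ℕ → ℕ} (hd : ∀ n, 0 < d n) (hdq : ∀ n, 20 * d n ≤ q n)
    (hqd : ∀ n, 20 * q n ≤ d (n + 1)) (u v : ℕ → Circle) :
    ∃ z : Circle, ∀ n, ‖((z ^ q n : Circle) : ℂ) - u n‖ ≤ 1 / 2 ∧
      ‖((z ^ (q n + d n) : Circle) : ℂ) - v n‖ ≤ 1 / 2 := by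
  have hd' : ∀ n, (0 : ℝ) < d n := fun n => by exact_mod_cast hd n
  have hdq' : ∀ n, (20 * d n : ℝ) ≤ q n := fun n => by exact_mod_cast hdq n
  have hqd' : ∀ n, (20 * q n : ℝ) ≤ d (n + 1) := fun n => by exact_mod_cast hqd n
  have hq' : ∀ n, (0 : ℝ) < q n := fun n => by linarith [hd' n, hdq' n]
  -- The frequency `d n` is served first, by `β`. The correction to `a'` for `q n` is at most `4 / q
  -- n`, which changes the phase at `d n` by at most `1 / 5`.
  have step : ∀ (n : ℕ) (a : ℝ), ∃ a', |a' - a| ≤ 4 / d n + 4 / q n ∧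
      Circle.exp (q n * a') = u n ∧
      ∃ β, |a' - β| ≤ 4 / q n ∧ Circle.exp (d n * β) = v n / u n := by
    intro n a
    obtain ⟨β, hβ, hβ'⟩ := exists_circle_exp_mul_eq a (hd' n) (v n / u n)
    obtain ⟨a', ha, ha'⟩ := exists_circle_exp_mul_eq β (hq' n) (u n)
    exact ⟨a', by linarith [abs_sub_le a' β a], ha', β, ha, hβ'⟩
  choose f hf₁ hf₂ hf₃ using step
  let α : ℕ → ℝ := fun n => Nat.rec (f 0 0) (fun n a => f (n + 1) a) n
  have hα : ∀ n, ∃ a, α n = f n a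
    | 0 => ⟨0, rfl⟩
    | n + 1 => ⟨α n, rfl⟩
  -- This nests the intervals of radius `1 / (4 * q n)` about `α n`; in units of `1 / q n` the left
  -- side is at most `1 / 5 + 1 / 100 + 1 / 1600`.
  have hstep : ∀ n, |α (n + 1) - α n| + 1 / (4 * q (n + 1)) ≤ 1 / (4 * q n) := by
    intro n
    have h : |α (n + 1) - α n| ≤ 4 / d (n + 1) + 4 / q (n + 1) := hf₁ (n + 1) (α n)
    have h₁ : 4 / (d (n + 1) : ℝ) ≤ 4 / (20 * q n) := by
      have := hq' n
      gcongr
      exact hqd' n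
    have h₂ : 1 / (q (n + 1) : ℝ) ≤ 1 / (400 * q n) := by
      have := hq' n
      gcongr
      linarith [hqd' n, hdq' (n + 1)]
    have e₁ : 4 / (20 * q n : ℝ) = (1 / q n) / 5 := by field_simp; norm_num
    have e₂ : 1 / (400 * q n : ℝ) = (1 / q n) / 400 := by field_simp
    have e₃ : 4 / (q (n + 1) : ℝ) = 4 * (1 / q (n + 1)) := by ring
    have e₄ : 1 / (4 * q (n + 1) : ℝ) = (1 / q (n + 1)) / 4 := by field_simp
    have e₅ : 1 / (4 * q n : ℝ) = (1 / q n) / 4 := by field_simp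
    have : 0 < 1 / (q n : ℝ) := one_div_pos.2 (hq' n)
    rw [e₄, e₅]
    rw [e₂] at h₂
    rw [e₁] at h₁
    rw [e₃] at h
    linarith
  have hmem := Monotone.ciSup_mem_iInter_Icc_of_antitone
    (f := fun n => α n - 1 / (4 * q n)) (g := fun n => α n + 1 / (4 * q n))
    (monotone_nat_of_le_succ fun n => by linarith [hstep n, neg_abs_le (α (n + 1) - α n)])
    (antitone_nat_of_succ_le fun n => by linarith [hstep n, le_abs_self (α (n + 1) - α n)])
    (fun n => by
      have : 0 < 1 / (4 * q n : ℝ) := by have := hq' n; positivity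
      simp only
      linarith)
  generalize (⨆ n, (α n - 1 / (4 * q n : ℝ))) = x at hmem
  refine ⟨Circle.exp x, fun n => ?_⟩
  have hx : |x - α n| ≤ 1 / (4 * q n) := by
    have := Set.mem_iInter.1 hmem n
    rw [abs_le]
    constructor <;> linarith [this.1, this.2]
  obtain ⟨a, ha⟩ := hα n
  obtain ⟨β, hβ, hβ'⟩ := hf₃ n a
  have hu := hf₂ n a
  rw [← ha] at hβ hu
  have h₁ : |q n * x - q n * α n| ≤ 1 / 4 := by
    rw [← mul_sub, abs_mul, abs_of_pos (hq' n)]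
    calc _ ≤ q n * (1 / (4 * q n) : ℝ) := by gcongr
      _ = 1 / 4 := by have := (hq' n).ne'; field_simp
  have h₂ : |d n * x - d n * β| ≤ 1 / 4 := by
    rw [← mul_sub, abs_mul, abs_of_pos (hd' n)]
    have h : |x - β| ≤ 1 / (4 * q n) + 4 / q n := (abs_sub_le x (α n) β).trans (add_le_add hx hβ)
    calc _ ≤ (q n / 20) * (1 / (4 * q n) + 4 / q n : ℝ) := by
          gcongr
          linarith [hdq' n]
      _ ≤ 1 / 4 := by
        have := (hq' n).ne'
        have e : (q n / 20) * (1 / (4 * q n) + 4 / q n : ℝ) = 17 / 80 := by field_simp; norm_num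
        rw [e]
        norm_num
  have hpow : ∀ m : ℕ, Circle.exp x ^ m = Circle.exp (m * x) := fun m => by
    rw [← nsmul_eq_mul, Circle.exp_nsmul]
  rw [hpow, hpow]
  constructor
  · rw [← hu]
    exact (norm_circle_exp_sub_le _ _).trans (h₁.trans (by norm_num))
  -- Since `v = u * (v / u)`, the two phase errors of at most `1 / 4` add up.
  · have hv : v n = Circle.exp (q n * α n + d n * β) := by
      rw [Circle.exp_add, hu, hβ', mul_div_cancel]
    rw [hv]
    refine (norm_circle_exp_sub_le _ _).trans ?_
    have := abs_add_le (q n * x - q n * α n) (d n * x - d n * β)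
    push_cast
    calc _ = |(q n * x - q n * α n) + (d n * x - d n * β)| := by congr 1; ring
      _ ≤ 1 / 2 := by linarith

/-! ### Fast-growing sequences and the conclusion -/

/-- `s` starts at a value at least `100` and `s (n + 1) ≥ 100 * s n ^ 2`. -/
structure IsFastGrowing (s : ℕ+ → ℕ+) : Prop where
  one : 100 ≤ s 1
  succ : ∀ n, 100 * s n ^ 2 ≤ s (n + 1)

namespace IsFastGrowing

variable {s : ℕ+ → ℕ+}

lemma mul_sq_le (hs : IsFastGrowing s) (n : ℕ+) : 100 * (s n : ℕ) ^ 2 ≤ s (n + 1) := by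
  exact_mod_cast hs.succ n

lemma mul_le (hs : IsFastGrowing s) (n : ℕ+) : 100 * (n : ℕ) ≤ s n := by
  induction n with
  | one => simpa using (PNat.coe_le_coe _ _).2 hs.one
  | succ n ih =>
    have h := hs.mul_sq_le n
    have := n.pos
    rw [PNat.add_coe, PNat.one_coe]
    nlinarith

lemma strictMono (hs : IsFastGrowing s) : StrictMono s :=
  strictMono_of_lt_add_one fun n _ => by
    have h := hs.mul_sq_le n
    have := (s n).pos
    rw [← PNat.coe_lt_coe]
    nlinarith

/-- The point `s m + m` lies strictly between `s m` and `s (m + 1)`. -/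
lemma ne_add (hs : IsFastGrowing s) (n m : ℕ+) : s n ≠ s m + m := by
  intro h
  rcases le_or_gt n m with hnm | hnm
  · exact absurd (h ▸ hs.strictMono.monotone hnm) (not_le.2 (PNat.lt_add_right _ _))
  · have h₁ : s (m + 1) ≤ s n := hs.strictMono.monotone (PNat.add_one_le_iff.2 hnm)
    rw [h, ← PNat.coe_le_coe, PNat.add_coe] at h₁
    have := hs.mul_sq_le m
    have := hs.mul_le m
    have := (s m).pos
    nlinarith

lemma infinite_shiftedUnion (hs : IsFastGrowing s) : (shiftedUnion s).Infinite :=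
  (Set.infinite_range_of_injective hs.strictMono.injective).mono Set.subset_union_left

theorem exists_isAlmostPeriodicSeq_eqOn_image_sq (hs : IsFastGrowing s) {b : ℕ+ → ℂ} {M : ℝ}
    (hb : ∀ n, ‖b n‖ ≤ M) : ∃ ψ, IsAlmostPeriodicSeq ψ ∧
      ∀ q ∈ (fun m : ℕ+ => m ^ 2) '' shiftedUnion s, ψ q = b q := by
  refine exists_isAlmostPeriodicSeq_eqOn (fun τ => ?_) hb
  have hpos : ∀ n : ℕ, 100 * (n + 1) ≤ (s n.succPNat : ℕ) := fun n => hs.mul_le n.succPNat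
  have hsucc : ∀ n : ℕ, 100 * (s n.succPNat : ℕ) ^ 2 ≤ s (n + 1).succPNat := fun n =>
    hs.mul_sq_le n.succPNat
  -- Here `d` is the gap between the two squares, with `n + 1` in place of `n`. The bound `100 * n ≤
  -- s n` gives `20 * d n ≤ q n`, and the quadratic growth of `s` gives `20 * q n ≤ d (n + 1)`.
  obtain ⟨z, hz⟩ := exists_circle_pow_near
    (d := fun n => 2 * (n + 1) * s n.succPNat + (n + 1) ^ 2) (q := fun n => (s n.succPNat : ℕ) ^ 2)
    (fun n => by positivity)
    (fun n => by nlinarith [hpos n])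
    (fun n => by nlinarith [hpos (n + 1), hsucc n])
    (fun n => τ (s n.succPNat ^ 2)) (fun n => τ ((s n.succPNat + n.succPNat) ^ 2))
  refine ⟨z, ?_⟩
  rintro _ ⟨_, ⟨n, rfl⟩ | ⟨n, rfl⟩, rfl⟩
  · have := (hz n.natPred).1
    rwa [PNat.succPNat_natPred] at this
  · have := (hz n.natPred).2
    rw [PNat.succPNat_natPred] at this
    convert this using 4
    push_cast
    rw [PNat.natPred_add_one]
    ring

theorem isStepI0_one_image_sq (hs : IsFastGrowing s) :
    IsStepI0 1 ((fun m : ℕ+ => m ^ 2) '' shiftedUnion s) :=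
  isStepI0_of_forall_exists
    (hs.infinite_shiftedUnion.image (pow_left_injective two_ne_zero).injOn)
    fun _ _ hb => hs.exists_isAlmostPeriodicSeq_eqOn_image_sq hb

theorem isStepI0_two (hs : IsFastGrowing s) : IsStepI0 2 (shiftedUnion s) := by
  refine isStepI0_of_forall_exists hs.infinite_shiftedUnion fun b M hb => ?_
  have hinj : Function.Injective fun m : ℕ+ => m ^ 2 := pow_left_injective two_ne_zero
  -- Interpolate on the squares, with the data moved there, and pull back along `n ↦ n ^ 2`.
  obtain ⟨θ, hθ, h⟩ := hs.exists_isAlmostPeriodicSeq_eqOn_image_sq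
    (b := fun q => b (Function.invFun (fun m : ℕ+ => m ^ 2) q)) fun n => hb _
  refine ⟨_, hθ.comp_sq, fun q hq => ?_⟩
  rw [h _ ⟨q, hq, rfl⟩]
  exact congrArg b (Function.leftInverse_invFun hinj q)

theorem not_isStepI0_one (hs : IsFastGrowing s) : ¬ IsStepI0 1 (shiftedUnion s) :=
  not_isStepI0_one_shiftedUnion hs.ne_add

end IsFastGrowing

lemma exists_isFastGrowing : ∃ s, IsFastGrowing s :=
  ⟨fun n => PNat.recOn n 100 fun _ m => 100 * m ^ 2,
    ⟨by simp, fun n => by simp⟩⟩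

theorem proposition1p6 :
    -- some set is `2`-step-`I₀` but not `1`-step-`I₀`
    (∃ E : Set ℕ+, IsStepI0 2 E ∧ ¬ IsStepI0 1 E) ∧
    -- examples: `{s n} ∪ {s n + n}` for every sufficiently fast-growing lacunary sequence `s`
    (∃ (C : ℕ+) (Φ : ℕ+ → ℕ+), ∀ s : ℕ+ → ℕ+, IsLacunarySeq s →
      C ≤ s 1 → (∀ n, Φ (s n) ≤ s (n + 1)) →
        IsStepI0 2 (shiftedUnion s) ∧ ¬ IsStepI0 1 (shiftedUnion s) ∧
        IsStepI0 1 ((fun m : ℕ+ => m ^ 2) '' shiftedUnion s)) ∧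
    -- squares turn almost periodic sequences into uniform limits of `2`-step nilsequences
    (∀ θ : ℕ+ → ℂ, IsAlmostPeriodicSeq θ → IsUniformLimitNil 2 (fun n => θ (n ^ 2))) := by
  obtain ⟨s, hs⟩ := exists_isFastGrowing
  refine ⟨⟨_, hs.isStepI0_two, hs.not_isStepI0_one⟩, ⟨100, fun m => 100 * m ^ 2, ?_⟩,
    fun θ hθ => hθ.comp_sq⟩
  intro t _ h₁ h₂
  have ht : IsFastGrowing t := ⟨h₁, h₂⟩
  exact ⟨ht.isStepI0_two, ht.not_isStepI0_one, ht.isStepI0_one_image_sq⟩
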